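/- Let ${}^*\mathbb{N}$, ${}^*\mathbb{R}$ be nonstandard extensions (ultrapowers) of $\mathbb{N}$, $\mathbb{R}$. Let $D\in\mathbb{N}$, let $N_0,\dots,N_D\in{}^*\mathbb{N}$ be unlimited, $\mathrm{I}_\iota=\{0,\frac1{N_\iota},\dots,\frac{N_\iota-1}{N_\iota},1\}$ and $\mathrm{I}=\mathrm{I}_0\times\dots\times\mathrm{I}_D$. The Lebesgue measure $\lambda$ of $\mathrm{I}$ (and likewise of each $\mathrm{I}_\iota$) gives the weight $\prod_\iota\frac1{N_\iota}$ to each point without coordinate $1$ and the weight $0$ to the other points; integrals are the corresponding hyperfinite sums. We write $a\approx b$ if $a-b$ is infinitesimal (coordinatewise, for points). Definitions, on $\mathrm{I}$ as on each $\mathrm{I}_\iota$: - A set $R$ is *rare* if for each standard real $r>0$ it is contained in an internal set of measure at most $r$. An internal set $A$ is *quadrable* if its boundary, the set of the points infinitely close both to a point of $A$ and to a point of its complement, is rare. - An internal function $f$ is *$S$-integrable* if $\int|f|\,d\lambda$ is limited and $\int_A|f|\,d\lambda\approx0$ for each internal set $A$ with $\lambda(A)\approx0$. It is *Lebesgue integrable*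 if it is $S$-integrable and there is a rare set $R$ such that $f(\xi)\approx f(\eta)$ whenever $\xi\approx\eta$ and $\xi,\eta\notin R$. It is *fast oscillating* if it is $S$-integrable and $\int_A f\,d\lambda\approx0$ for each quadrable set $A$. - Let $m:\mathrm{I}\to{}^*\mathbb{R}$ be Lebesgue integrable. A *noise of mean $m$* is an $S$-integrable function $\mathfrak{n}:\mathrm{I}\to{}^*\mathbb{R}$ such that, for each $\iota\in\{0,\dots,D\}$ and all $\xi_\kappa\in\mathrm{I}_\kappa$ ($\kappa\neq\iota$), the function $\mathfrak{n}(\xi_0,\dots,\xi_D)-m(\xi_0,\dots,\xi_D)$ of $\xi_\iota\in\mathrm{I}_\iota$ is fast oscillating. A *noise* is a noise of some mean. - An internal function $f:\mathrm{I}\to{}^*\mathbb{R}$ is of *class $S^0$* if all its values are limited and $f(\xi)\approx f(\eta)$ whenever $\xi\approx\eta$. It is of *class $S^1$* if it is of class $S^0$ and there are functions $g_0,\dots,g_D$ of class $S^0$ on $\mathrm{I}$ such that $\bigl(f(\eta)-f(\xi)-\sum_\iota g_\iota(\xi)(\eta_\iota-\xi_\iota)\bigr)\big/\sum_\iota|\eta_\iota-\xi_\iota|\approx0$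 whenever $\xi\approx\eta$ and $\xi\ne\eta$. **Proposition 2.** Let $x:\mathrm{I}\to{}^*\mathbb{R}$ be a signal of class $S^1$ and let $y=\mathfrak{n}_1x+\mathfrak{n}_2$, where $\mathfrak{n}_1$ is a noise of mean $1$ and $\mathfrak{n}_2$ is a noise of arbitrary mean. Then $y=x+\mathfrak{n}$, where $\mathfrak{n}=\mathfrak{n}_2+(\mathfrak{n}_1-1)x$ is a noise with the same mean as $\mathfrak{n}_2$: a function $m$ is a mean of $\mathfrak{n}$ if and only if it is a mean of $\mathfrak{n}_2$. -/

import Mathlib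

open Filter

noncomputable section

namespace NSNoise

/-- The nonstandard extension `*α`: the ultrapower of `α` along an ultrafilter `U`. -/
abbrev Star {J : Type*} (U : Ultrafilter J) (α : Type*) : Type _ := Germ (U : Filter J) α

section
variable {J : Type*} {U : Ultrafilter J}

/-- The inclusion `*ℕ → *ℝ`. -/
def natCast (n : Star U ℕ) : Star U ℝ := n.map (fun k : ℕ => (k : ℝ))

/-- A hypernatural number is unlimited if it exceeds every standard natural number. -/
def Unlimited (n : Star U ℕ) : Prop := ∀ k : ℕ, Germ.const k < n

/-- A hyperreal number is limited if it is bounded by a standard real number. -/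
def Limited (x : Star U ℝ) : Prop := ∃ r : ℝ, |x| ≤ Germ.const r

/-- A hyperreal number is infinitesimal if it is smaller in absolute value than every
standard positive real number. -/
def Infinitesimal (x : Star U ℝ) : Prop := ∀ r : ℝ, 0 < r → |x| < Germ.const r

/-- The hyperfinite set `{0, 1/N, …, (N-1)/N, 1}`. -/
def axis (N : Star U ℕ) : Set (Star U ℝ) :=
  {t | ∃ k : Star U ℕ, k ≤ N ∧ t = natCast k / natCast N}

variable {ι : Type*}

/-- The hyperfinite grid `I`, the product of the sets `{0, 1/N_i, …, (N_i-1)/N_i, 1}`. -/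
def grid (N : ι → Star U ℕ) : Set (ι → Star U ℝ) := {ξ | ∀ i, ξ i ∈ axis (N i)}

variable {N : ι → Star U ℕ}

/-- Two points of the grid are infinitely close. -/
def Near (ξ η : grid N) : Prop := ∀ i, Infinitesimal (ξ.1 i - η.1 i)

/-- The function `f : I → *ℝ` is the one induced by the family `F` of real functions. -/
def Represents (F : J → (ι → ℝ) → ℝ) (f : grid N → Star U ℝ) : Prop :=
  ∀ (ξ : J → ι → ℝ) (h : (fun i => Germ.ofFun (fun j => ξ j i)) ∈ grid N),
    f ⟨fun i => Germ.ofFun (fun j => ξ j i), h⟩ = Germ.ofFun (fun j => F j (ξ j))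

/-- Internal functions `I → *ℝ`. -/
def IsInternal (f : grid N → Star U ℝ) : Prop := ∃ F, Represents F f

/-- Internal subsets of `I`: those whose indicator function is internal. -/
def IsInternalSet (A : Set (grid N)) : Prop := IsInternal (A.indicator 1)

open scoped Classical in
/-- The sum of `G(k/n) / ∏ n_i` over the multi-indices `k` with `0 ≤ k_i ≤ n_i - 1`. -/
def gridSum [Fintype ι] (n : ι → ℕ) (G : (ι → ℝ) → ℝ) : ℝ :=
  ∑ k ∈ Fintype.piFinset (fun i => Finset.range (n i)),
    G (fun i => (k i : ℝ) / (n i : ℝ)) * ∏ i, (1 / (n i : ℝ))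

open scoped Classical in
/-- The integral `∫_A f dλ` of an internal function over an internal set, for the Lebesgue measure
`λ` of `I`: the hyperfinite sum of the values of `f` at the points of `A` without coordinate `1`,
each with the weight `∏ 1/N_i`. It does not depend on the representatives, see `integral_eq`. -/
def integral [Fintype ι] (A : Set (grid N)) (f : grid N → Star U ℝ) : Star U ℝ :=
  if h : IsInternal (A.indicator f) then
    Germ.ofFun (fun j => gridSum (fun i => (Quotient.out (N i) : J → ℕ) j) (h.choose j))
  else 0

theorem integral_eq [Fintype ι] (A : Set (grid N)) (f : grid N → Star U ℝ)
    (F : J → (ι → ℝ) → ℝ) (hF : Represents F (A.indicator f))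
    (n : J → ι → ℕ) (hn : ∀ i, N i = Germ.ofFun (fun j => n j i)) :
    integral A f = Germ.ofFun (fun j => gridSum (n j) (F j)) := by
  classical
  have h : IsInternal (A.indicator f) := ⟨F, hF⟩
  have hG := h.choose_spec
  rw [integral, dif_pos h]
  generalize h.choose = G at hG
  have hm : ∀ᶠ j in (U : Filter J), ∀ i, (Quotient.out (N i) : J → ℕ) j = n j i := by
    rw [eventually_all]
    intro i
    exact Germ.coe_eq.1 ((Quotient.out_eq (N i)).trans (hn i))
  have hk : ∀ j, ∃ k : ι → ℕ, (∀ i, k i ≤ n j i) ∧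
      ((∃ l : ι → ℕ, (∀ i, l i ≤ n j i) ∧ G j (fun i => (l i : ℝ) / (n j i : ℝ)) ≠
        F j (fun i => (l i : ℝ) / (n j i : ℝ))) →
        G j (fun i => (k i : ℝ) / (n j i : ℝ)) ≠ F j (fun i => (k i : ℝ) / (n j i : ℝ))) := by
    intro j
    by_cases hb : ∃ l : ι → ℕ, (∀ i, l i ≤ n j i) ∧ G j (fun i => (l i : ℝ) / (n j i : ℝ)) ≠
        F j (fun i => (l i : ℝ) / (n j i : ℝ))
    · obtain ⟨l, hl, hl'⟩ := hb
      exact ⟨l, hl, fun _ => hl'⟩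
    · exact ⟨0, fun i => Nat.zero_le _, fun h' => absurd h' hb⟩
  choose k hk hk' using hk
  have hmem : (fun i => Germ.ofFun (fun j => (k j i : ℝ) / (n j i : ℝ))) ∈ grid N := by
    intro i
    refine ⟨Germ.ofFun (fun j => k j i), ?_, ?_⟩
    · rw [hn i]
      exact Germ.coe_le.2 (Eventually.of_forall fun j => hk j i)
    · rw [hn i]
      rfl
  have e := (hG (fun j i => (k j i : ℝ) / (n j i : ℝ)) hmem).symm.trans
    (hF (fun j i => (k j i : ℝ) / (n j i : ℝ)) hmem)
  refine Germ.coe_eq.2 ?_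
  filter_upwards [hm, Germ.coe_eq.1 e] with j hmj hj
  have hmj' : (fun i => (Quotient.out (N i) : J → ℕ) j) = n j := funext hmj
  rw [hmj', gridSum, gridSum]
  refine Finset.sum_congr rfl fun l hl => ?_
  congr 1
  by_contra hne
  exact hk' j ⟨l, fun i => (Finset.mem_range.1 (Fintype.mem_piFinset.1 hl i)).le, hne⟩ hj

/-- The Lebesgue measure `λ(A)` of an internal subset of `I`. -/
def measure [Fintype ι] (A : Set (grid N)) : Star U ℝ := integral A 1

/-- A subset of `I`, internal or external, is rare if it is contained in internal subsets of
arbitrarily small standard positive measure. -/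
def IsRare [Fintype ι] (R : Set (grid N)) : Prop :=
  ∀ r : ℝ, 0 < r → ∃ B : Set (grid N), IsInternalSet B ∧ R ⊆ B ∧ measure B ≤ Germ.const r

/-- The boundary of `A`: the points infinitely close to both `A` and its complement. -/
def boundary (A : Set (grid N)) : Set (grid N) :=
  {ξ | (∃ η ∈ A, Near ξ η) ∧ ∃ ζ ∉ A, Near ξ ζ}

/-- Quadrable sets: internal sets with a rare boundary. -/
def IsQuadrable [Fintype ι] (A : Set (grid N)) : Prop := IsInternalSet A ∧ IsRare (boundary A)

/-- `S`-integrable functions: internal functions such that `∫ |f| dλ` is limited, and `∫_A |f| dλ`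
is infinitesimal for each internal `A` of infinitesimal measure. -/
def SIntegrable [Fintype ι] (f : grid N → Star U ℝ) : Prop :=
  IsInternal f ∧ Limited (integral Set.univ (fun ξ => |f ξ|)) ∧
    ∀ A : Set (grid N), IsInternalSet A → Infinitesimal (measure A) →
      Infinitesimal (integral A (fun ξ => |f ξ|))

/-- Lebesgue integrable functions: `S`-integrable functions that are `S`-continuous on the
complement of a rare set. -/
def LebesgueIntegrable [Fintype ι] (f : grid N → Star U ℝ) : Prop :=
  SIntegrable f ∧ ∃ R : Set (grid N), IsRare R ∧
    ∀ ξ η : grid N, ξ ∉ R → η ∉ R → Near ξ η → Infinitesimal (f ξ - f η)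

/-- Fast oscillating functions. -/
def FastOscillating [Fintype ι] (f : grid N → Star U ℝ) : Prop :=
  SIntegrable f ∧ ∀ A : Set (grid N), IsQuadrable A → Infinitesimal (integral A f)

/-- Replacing the coordinate `i` of a point of the grid by a point of the axis `I_i`. -/
def insertCoord [DecidableEq ι] (i : ι) (ξ : grid N) (t : grid (fun _ : Unit => N i)) : grid N :=
  ⟨Function.update ξ.1 i (t.1 ()), fun j => by
    by_cases h : j = i
    · subst h
      simpa using t.2 ()
    · simpa [Function.update_of_ne h] using ξ.2 j⟩

/-- The projection `f(ξ_0, …, ξ_{i-1}, ·, ξ_{i+1}, …) : I_i → *ℝ`; it does not depend on `ξ_i`. -/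
def slice [DecidableEq ι] (f : grid N → Star U ℝ) (i : ι) (ξ : grid N) :
    grid (fun _ : Unit => N i) → Star U ℝ :=
  fun t => f (insertCoord i ξ t)

/-- The function `𝔫` is a noise of mean `m`. -/
def IsNoiseOfMean [Fintype ι] [DecidableEq ι] (𝔫 m : grid N → Star U ℝ) : Prop :=
  LebesgueIntegrable m ∧ SIntegrable 𝔫 ∧
    ∀ (i : ι) (ξ : grid N), FastOscillating (slice (𝔫 - m) i ξ)

/-- The function `𝔫` is a noise (of some mean). -/
def IsNoise [Fintype ι] [DecidableEq ι] (𝔫 : grid N → Star U ℝ) : Prop :=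
  ∃ m, IsNoiseOfMean 𝔫 m

/-- Functions of class `S⁰`: internal, with limited values, and `S`-continuous on `I`. -/
def IsClassS0 (f : grid N → Star U ℝ) : Prop :=
  IsInternal f ∧ (∀ ξ, Limited (f ξ)) ∧ ∀ ξ η, Near ξ η → Infinitesimal (f ξ - f η)

/-- Functions of class `S¹`: functions of class `S⁰` with a gradient `(g_i)` of class `S⁰` such that
`f(η) - f(ξ) - ∑ g_i(ξ) (η_i - ξ_i)` is infinitesimal relatively to `∑ |η_i - ξ_i|` for all
distinct infinitely close points `ξ`, `η`. -/
def IsClassS1 [Fintype ι] (f : grid N → Star U ℝ) : Prop :=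
  IsClassS0 f ∧ ∃ g : ι → grid N → Star U ℝ, (∀ i, IsClassS0 (g i)) ∧
    ∀ ξ η : grid N, Near ξ η → ξ ≠ η →
      Infinitesimal ((f η - f ξ - ∑ i, g i ξ * (η.1 i - ξ.1 i)) / ∑ i, |η.1 i - ξ.1 i|)

end

end NSNoise

end

/-! The identity `y = x + (𝔫₂ + (𝔫₁ - 1) * x)` is algebra. What has to be shown is that the centred
product `(𝔫₁ - 1) * x` is `S`-integrable with fast oscillating slices: such a function can be added
to a noise or subtracted from it without changing the possible means.

`S`-integrability holds because an internal function with limited values has a standard bound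
(`exists_uniform_bound`). The slices reduce to a statement on one axis
(`FastOscillating.mul_isClassS0`): if `h` is fast oscillating and `c` is of class `S⁰`, then `h * c`
is fast oscillating. To see this, approximate `c` within a standard `ε` by a step function on
finitely many intervals of standard length (`IsClassS0.exists_step`). Intervals are built from
quadrable sets, and these are stable under intersection, so over a quadrable `A` each step
contributes a limited constant times an infinitesimal integral of `h`. The remainder is at most `ε ∫
|h|`, with `∫ |h|` limited and `ε` arbitrary.

The step approximation needs a standard modulus of continuity, extracted from `S`-continuity by
`IsClassS0.exists_modulus`. Overspill and transfer are replaced throughout by choosing extremal or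
offending grid points at each index of the ultrapower. -/

namespace NSNoise

/-! ### Internal functions and sets. -/

section Represents
variable {J : Type*} {U : Ultrafilter J} {ι : Type*} {N : ι → Star U ℕ}

/-- The point of the grid with the coordinates `k i / n i`. -/
noncomputable def gridPoint {n k : J → ι → ℕ} (hn : ∀ i, N i = Germ.ofFun (fun j => n j i))
    (hk : ∀ j i, k j i ≤ n j i) : grid N :=
  ⟨fun i => Germ.ofFun (fun j => (k j i : ℝ) / (n j i : ℝ)), fun i =>
    ⟨Germ.ofFun (fun j => k j i), by
      rw [hn i]; exact Germ.coe_le.2 (Eventually.of_forall fun j => hk j i), by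
      rw [hn i]; rfl⟩⟩

theorem exists_representatives (N : ι → Star U ℕ) :
    ∃ n : J → ι → ℕ, ∀ i, N i = Germ.ofFun (fun j => n j i) :=
  ⟨fun j i => (Quotient.out (N i) : J → ℕ) j, fun i => (Quotient.out_eq (N i)).symm⟩

theorem exists_eq_gridPoint {n : J → ι → ℕ} (hn : ∀ i, N i = Germ.ofFun (fun j => n j i))
    (ξ : grid N) : ∃ (k : J → ι → ℕ) (hk : ∀ j i, k j i ≤ n j i), ξ = gridPoint hn hk := by
  have h : ∀ i, ∃ k : J → ℕ, (∀ j, k j ≤ n j i) ∧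
      ξ.1 i = Germ.ofFun (fun j => (k j : ℝ) / (n j i : ℝ)) := by
    intro i
    obtain ⟨κ, hκ, e⟩ := ξ.2 i
    induction κ using Germ.inductionOn with | _ k =>
    rw [hn i] at hκ e
    -- Truncation makes the bound hold at every index; the germ is unchanged, since `k j ≤ n j i`
    -- already held for almost every `j`.
    refine ⟨fun j => min (k j) (n j i), fun j => min_le_right _ _, ?_⟩
    rw [e]
    refine Germ.coe_eq.2 ?_
    filter_upwards [Germ.coe_le.1 hκ] with j hj
    simp [min_eq_left hj]
  choose k hk e using h
  exact ⟨fun j i => k i j, fun j i => hk i j, Subtype.ext (funext e)⟩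

theorem Represents.apply_gridPoint {F : J → (ι → ℝ) → ℝ} {f : grid N → Star U ℝ}
    (h : Represents F f) {n k : J → ι → ℕ} (hn : ∀ i, N i = Germ.ofFun (fun j => n j i))
    (hk : ∀ j i, k j i ≤ n j i) :
    f (gridPoint hn hk) = Germ.ofFun (fun j => F j (fun i => (k j i : ℝ) / (n j i : ℝ))) :=
  h (fun j i => (k j i : ℝ) / (n j i : ℝ)) (gridPoint hn hk).2

/-- Transfer of a universal statement over the grid: choosing a counterexample at each index where
one exists gives a single sequence of multi-indices, and testing `p` on it tests all of them. -/
theorem eventually_forall_of_gridPoints {n : J → ι → ℕ} {p : J → (ι → ℕ) → Prop}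
    (h : ∀ k : J → ι → ℕ, (∀ j i, k j i ≤ n j i) → ∀ᶠ j in (U : Filter J), p j (k j)) :
    ∀ᶠ j in (U : Filter J), ∀ k : ι → ℕ, (∀ i, k i ≤ n j i) → p j k := by
  have hk : ∀ j, ∃ k : ι → ℕ, (∀ i, k i ≤ n j i) ∧
      (p j k → ∀ l : ι → ℕ, (∀ i, l i ≤ n j i) → p j l) := by
    intro j
    by_cases hb : ∀ l : ι → ℕ, (∀ i, l i ≤ n j i) → p j l
    · exact ⟨0, fun i => Nat.zero_le _, fun _ => hb⟩
    · push Not at hb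
      obtain ⟨l, hl, hl'⟩ := hb
      exact ⟨l, hl, fun h' => absurd h' hl'⟩
  choose k hk hk' using hk
  filter_upwards [h k hk] with j hj using hk' j hj

theorem Represents.add {F G : J → (ι → ℝ) → ℝ} {f g : grid N → Star U ℝ}
    (hF : Represents F f) (hG : Represents G g) : Represents (F + G) (f + g) := fun ξ h => by
  rw [Pi.add_apply, hF ξ h, hG ξ h]; rfl

theorem Represents.mul {F G : J → (ι → ℝ) → ℝ} {f g : grid N → Star U ℝ}
    (hF : Represents F f) (hG : Represents G g) : Represents (F * G) (f * g) := fun ξ h => by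
  rw [Pi.mul_apply, hF ξ h, hG ξ h]; rfl

theorem germ_abs_coe (f : J → ℝ) :
    |(Germ.ofFun f : Star U ℝ)| = Germ.ofFun (fun j => |f j|) := Germ.abs_def _

theorem Represents.abs {F : J → (ι → ℝ) → ℝ} {f : grid N → Star U ℝ}
    (hF : Represents F f) : Represents (fun j ξ => |F j ξ|) (fun ξ => |f ξ|) := fun ξ h => by
  simp only [hF ξ h, germ_abs_coe]

theorem isInternal_const (c : Star U ℝ) : IsInternal (fun _ : grid N => c) := by
  induction c using Germ.inductionOn with | _ c =>
  exact ⟨fun j _ => c j, fun ξ h => rfl⟩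

theorem IsInternal.add {f g : grid N → Star U ℝ} (hf : IsInternal f) (hg : IsInternal g) :
    IsInternal (f + g) := by
  obtain ⟨F, hF⟩ := hf
  obtain ⟨G, hG⟩ := hg
  exact ⟨_, hF.add hG⟩

theorem IsInternal.mul {f g : grid N → Star U ℝ} (hf : IsInternal f) (hg : IsInternal g) :
    IsInternal (f * g) := by
  obtain ⟨F, hF⟩ := hf
  obtain ⟨G, hG⟩ := hg
  exact ⟨_, hF.mul hG⟩

theorem IsInternal.neg {f : grid N → Star U ℝ} (hf : IsInternal f) : IsInternal (-f) := by
  have h := (isInternal_const (N := N) (-1)).mul hf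
  convert h using 1
  ext ξ
  simp

theorem IsInternal.sub {f g : grid N → Star U ℝ} (hf : IsInternal f) (hg : IsInternal g) :
    IsInternal (f - g) := by
  rw [sub_eq_add_neg]; exact hf.add hg.neg

theorem IsInternal.abs {f : grid N → Star U ℝ} (hf : IsInternal f) :
    IsInternal (fun ξ => |f ξ|) := by
  obtain ⟨F, hF⟩ := hf
  exact ⟨_, hF.abs⟩

theorem IsInternal.sum {α : Type*} (s : Finset α) {f : α → grid N → Star U ℝ}
    (hf : ∀ a ∈ s, IsInternal (f a)) : IsInternal (∑ a ∈ s, f a) := by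
  classical
  induction s using Finset.induction_on with
  | empty => exact isInternal_const 0
  | insert a s ha ih =>
    rw [Finset.sum_insert ha]
    exact (hf a (Finset.mem_insert_self a s)).add
      (ih fun b hb => hf b (Finset.mem_insert_of_mem hb))

theorem IsInternalSet.indicator {A : Set (grid N)} (hA : IsInternalSet A)
    {f : grid N → Star U ℝ} (hf : IsInternal f) : IsInternal (A.indicator f) := by
  have h := IsInternal.mul hA hf
  convert h using 1
  ext ξ
  by_cases hξ : ξ ∈ A <;> simp [hξ]

theorem IsInternalSet.univ : IsInternalSet (Set.univ : Set (grid N)) := by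
  rw [IsInternalSet, Set.indicator_univ]; exact isInternal_const 1

theorem IsInternalSet.inter {A B : Set (grid N)} (hA : IsInternalSet A) (hB : IsInternalSet B) :
    IsInternalSet (A ∩ B) := by
  rw [IsInternalSet, ← Set.indicator_indicator]
  exact hA.indicator hB

theorem IsInternalSet.union {A B : Set (grid N)} (hA : IsInternalSet A) (hB : IsInternalSet B) :
    IsInternalSet (A ∪ B) := by
  have h := (IsInternal.add hA hB).sub (hA.inter hB)
  rw [IsInternalSet]
  convert h using 1
  rw [eq_sub_iff_add_eq, Set.indicator_union_add_inter]

end Represents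

/-! ### Linearity and monotonicity of the hyperfinite integral. -/

section Integral
variable {J : Type*} {U : Ultrafilter J} {ι : Type*} [Fintype ι] {N : ι → Star U ℕ}

theorem integral_congr {A B : Set (grid N)} {f g : grid N → Star U ℝ}
    (h : A.indicator f = B.indicator g) : integral A f = integral B g := by
  unfold integral
  rw [h]

/-- Reduces integrals over `A` to integrals over the whole grid, where representatives can be summed
directly. -/
theorem integral_indicator (A : Set (grid N)) (f : grid N → Star U ℝ) :
    integral Set.univ (A.indicator f) = integral A f :=
  integral_congr (Set.indicator_univ _)

theorem integral_inter (A B : Set (grid N)) (f : grid N → Star U ℝ) :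
    integral (A ∩ B) f = integral A (B.indicator f) :=
  integral_congr (Set.indicator_indicator _ _ _).symm

theorem integral_univ_eq {f : grid N → Star U ℝ} {F : J → (ι → ℝ) → ℝ} (hF : Represents F f)
    {n : J → ι → ℕ} (hn : ∀ i, N i = Germ.ofFun (fun j => n j i)) :
    integral Set.univ f = Germ.ofFun (fun j => gridSum (n j) (F j)) :=
  integral_eq _ _ _ (by rwa [Set.indicator_univ]) _ hn

theorem integral_univ_add {f g : grid N → Star U ℝ} (hf : IsInternal f) (hg : IsInternal g) :
    integral Set.univ (f + g) = integral Set.univ f + integral Set.univ g := by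
  obtain ⟨F, hF⟩ := hf
  obtain ⟨G, hG⟩ := hg
  obtain ⟨n, hn⟩ := exists_representatives N
  rw [integral_univ_eq hF hn, integral_univ_eq hG hn, integral_univ_eq (hF.add hG) hn]
  refine congrArg Germ.ofFun (funext fun j => ?_)
  simp [gridSum, add_mul, Finset.sum_add_distrib]

theorem integral_univ_const_mul (c : Star U ℝ) {f : grid N → Star U ℝ} (hf : IsInternal f) :
    integral Set.univ (fun ξ => c * f ξ) = c * integral Set.univ f := by
  obtain ⟨F, hF⟩ := hf
  obtain ⟨n, hn⟩ := exists_representatives N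
  induction c using Germ.inductionOn with | _ c =>
  have hc : Represents (fun j ξ => c j * F j ξ) (fun ξ : grid N => (c : Star U ℝ) * f ξ) :=
    fun ξ h => by simp only [hF ξ h]; rfl
  rw [integral_univ_eq hF hn, integral_univ_eq hc hn]
  refine congrArg Germ.ofFun (funext fun j => ?_)
  simp [gridSum, mul_assoc, Finset.mul_sum]

theorem integral_univ_mono {f g : grid N → Star U ℝ} (hf : IsInternal f) (hg : IsInternal g)
    (h : ∀ ξ, f ξ ≤ g ξ) : integral Set.univ f ≤ integral Set.univ g := by
  classical
  obtain ⟨F, hF⟩ := hf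
  obtain ⟨G, hG⟩ := hg
  obtain ⟨n, hn⟩ := exists_representatives N
  rw [integral_univ_eq hF hn, integral_univ_eq hG hn]
  refine Germ.coe_le.2 ?_
  have key := eventually_forall_of_gridPoints (U := U) (n := n)
    (p := fun j k => F j (fun i => (k i : ℝ) / (n j i : ℝ)) ≤
      G j (fun i => (k i : ℝ) / (n j i : ℝ))) fun k hk => by
        have := h (gridPoint hn hk)
        rw [hF.apply_gridPoint, hG.apply_gridPoint] at this
        exact Germ.coe_le.1 this
  filter_upwards [key] with j hj
  refine Finset.sum_le_sum fun k hk => ?_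
  refine mul_le_mul_of_nonneg_right (hj k fun i => ?_)
    (Finset.prod_nonneg fun i _ => by positivity)
  exact (Finset.mem_range.1 (Fintype.mem_piFinset.1 hk i)).le

theorem integral_add {A : Set (grid N)} (hA : IsInternalSet A) {f g : grid N → Star U ℝ}
    (hf : IsInternal f) (hg : IsInternal g) :
    integral A (f + g) = integral A f + integral A g := by
  simp only [← integral_indicator A]
  rw [Set.indicator_add', integral_univ_add (hA.indicator hf) (hA.indicator hg)]

theorem integral_const_mul {A : Set (grid N)} (hA : IsInternalSet A) (c : Star U ℝ)
    {f : grid N → Star U ℝ} (hf : IsInternal f) :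
    integral A (fun ξ => c * f ξ) = c * integral A f := by
  simp only [← integral_indicator A]
  rw [← integral_univ_const_mul c (hA.indicator hf)]
  congr 1
  ext ξ
  by_cases hξ : ξ ∈ A <;> simp [hξ]

theorem integral_neg {A : Set (grid N)} (hA : IsInternalSet A)
    {f : grid N → Star U ℝ} (hf : IsInternal f) : integral A (-f) = -integral A f := by
  have h := integral_const_mul hA (-1) hf
  rw [neg_one_mul] at h
  rw [← h]
  congr 1
  ext ξ
  simp

theorem integral_sub {A : Set (grid N)} (hA : IsInternalSet A) {f g : grid N → Star U ℝ}
    (hf : IsInternal f) (hg : IsInternal g) :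
    integral A (f - g) = integral A f - integral A g := by
  rw [sub_eq_add_neg, integral_add hA hf hg.neg, integral_neg hA hg, sub_eq_add_neg]

theorem integral_sum {A : Set (grid N)} (hA : IsInternalSet A) {α : Type*} (s : Finset α)
    {f : α → grid N → Star U ℝ} (hf : ∀ a ∈ s, IsInternal (f a)) :
    integral A (∑ a ∈ s, f a) = ∑ a ∈ s, integral A (f a) := by
  classical
  induction s using Finset.induction_on with
  | empty =>
    have h := integral_const_mul hA 0 (isInternal_const (N := N) 0)
    simp only [zero_mul] at h
    rw [Finset.sum_empty, Finset.sum_empty]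
    exact h
  | insert a s ha ih =>
    have hs : ∀ b ∈ s, IsInternal (f b) := fun b hb => hf b (Finset.mem_insert_of_mem hb)
    rw [Finset.sum_insert ha, Finset.sum_insert ha,
      integral_add hA (hf a (Finset.mem_insert_self a s)) (IsInternal.sum s hs), ih hs]

theorem integral_mono {A : Set (grid N)} (hA : IsInternalSet A) {f g : grid N → Star U ℝ}
    (hf : IsInternal f) (hg : IsInternal g) (h : ∀ ξ ∈ A, f ξ ≤ g ξ) :
    integral A f ≤ integral A g := by
  rw [← integral_indicator A, ← integral_indicator A]
  refine integral_univ_mono (hA.indicator hf) (hA.indicator hg) fun ξ => ?_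
  by_cases hξ : ξ ∈ A
  · simpa [hξ] using h ξ hξ
  · simp [hξ]

theorem abs_integral_le {A : Set (grid N)} (hA : IsInternalSet A) {f : grid N → Star U ℝ}
    (hf : IsInternal f) : |integral A f| ≤ integral A (fun ξ => |f ξ|) := by
  rw [abs_le']
  refine ⟨integral_mono hA hf hf.abs fun ξ _ => le_abs_self _, ?_⟩
  rw [← integral_neg hA hf]
  exact integral_mono hA hf.neg hf.abs fun ξ _ => neg_le_abs _

theorem integral_nonneg {A : Set (grid N)} (hA : IsInternalSet A) {f : grid N → Star U ℝ}
    (hf : IsInternal f) (h : ∀ ξ ∈ A, 0 ≤ f ξ) : 0 ≤ integral A f := by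
  have h0 := integral_const_mul hA 0 hf
  rw [zero_mul] at h0
  rw [← h0]
  exact integral_mono hA ((isInternal_const 0).mul hf) hf fun ξ hξ => by simpa using h ξ hξ

theorem integral_mono_set {A B : Set (grid N)} (hA : IsInternalSet A) (hB : IsInternalSet B)
    (hAB : A ⊆ B) {f : grid N → Star U ℝ} (hf : IsInternal f) (h : ∀ ξ, 0 ≤ f ξ) :
    integral A f ≤ integral B f := by
  rw [← integral_indicator A, ← integral_indicator B]
  exact integral_univ_mono (hA.indicator hf) (hB.indicator hf)
    (Set.indicator_le_indicator_of_subset hAB h)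

theorem measure_union_le {A B : Set (grid N)} (hA : IsInternalSet A) (hB : IsInternalSet B) :
    measure (A ∪ B) ≤ measure A + measure B := by
  simp only [measure]
  rw [← integral_indicator A, ← integral_indicator B, ← integral_indicator (A ∪ B),
    ← integral_univ_add hA hB]
  refine integral_univ_mono (hA.union hB) (IsInternal.add hA hB) fun ξ => ?_
  by_cases h₁ : ξ ∈ A <;> by_cases h₂ : ξ ∈ B <;> simp [h₁, h₂]

end Integral

/-! ### Arithmetic of limited and infinitesimal hyperreals. -/

section Infinitesimal
variable {J : Type*} {U : Ultrafilter J}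

theorem const_add (r s : ℝ) :
    (Germ.const r : Star U ℝ) + Germ.const s = Germ.const (r + s) := rfl

theorem const_mul (r s : ℝ) :
    (Germ.const r : Star U ℝ) * Germ.const s = Germ.const (r * s) := rfl

theorem const_lt_const {r s : ℝ} : (Germ.const r : Star U ℝ) < Germ.const s ↔ r < s :=
  Germ.const_lt_iff

theorem const_le_const {r s : ℝ} : (Germ.const r : Star U ℝ) ≤ Germ.const s ↔ r ≤ s :=
  Germ.const_le_iff

theorem const_pos {r : ℝ} (hr : 0 < r) : (0 : Star U ℝ) < Germ.const r := const_lt_const.2 hr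

theorem Infinitesimal.zero : Infinitesimal (0 : Star U ℝ) := fun r hr => by
  rw [abs_zero]; exact const_pos hr

theorem Infinitesimal.add {a b : Star U ℝ} (ha : Infinitesimal a) (hb : Infinitesimal b) :
    Infinitesimal (a + b) := fun r hr => by
  have h := add_lt_add (ha (r / 2) (half_pos hr)) (hb (r / 2) (half_pos hr))
  rw [const_add, add_halves] at h
  exact (abs_add_le a b).trans_lt h

theorem Infinitesimal.of_abs_le {a b : Star U ℝ} (hb : Infinitesimal b) (h : |a| ≤ |b|) :
    Infinitesimal a := fun r hr => h.trans_lt (hb r hr)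

theorem Infinitesimal.neg {a : Star U ℝ} (ha : Infinitesimal a) : Infinitesimal (-a) :=
  ha.of_abs_le (abs_neg a).le

theorem Infinitesimal.sub {a b : Star U ℝ} (ha : Infinitesimal a) (hb : Infinitesimal b) :
    Infinitesimal (a - b) := by
  rw [sub_eq_add_neg]; exact ha.add hb.neg

theorem Limited.exists_pos {c : Star U ℝ} (hc : Limited c) :
    ∃ C : ℝ, 0 < C ∧ |c| ≤ Germ.const C := by
  obtain ⟨C, hC⟩ := hc
  refine ⟨|C| + 1, by positivity, hC.trans (const_le_const.2 ?_)⟩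
  linarith [le_abs_self C]

theorem Limited.mul_infinitesimal {c a : Star U ℝ} (hc : Limited c) (ha : Infinitesimal a) :
    Infinitesimal (c * a) := fun r hr => by
  obtain ⟨C, hC0, hC⟩ := hc.exists_pos
  have h := mul_lt_mul_of_pos_left (ha (r / C) (div_pos hr hC0)) (const_pos (U := U) hC0)
  rw [const_mul, mul_div_cancel₀ _ hC0.ne'] at h
  rw [abs_mul]
  exact (mul_le_mul_of_nonneg_right hC (abs_nonneg a)).trans_lt h

theorem Limited.of_abs_le {a b : Star U ℝ} (hb : Limited b) (h : |a| ≤ |b|) : Limited a :=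
  hb.imp fun _ hr => h.trans hr

theorem Limited.add {a b : Star U ℝ} (ha : Limited a) (hb : Limited b) : Limited (a + b) := by
  obtain ⟨r, hr⟩ := ha
  obtain ⟨s, hs⟩ := hb
  exact ⟨r + s, (abs_add_le a b).trans (add_le_add hr hs)⟩

theorem Limited.mul {a b : Star U ℝ} (ha : Limited a) (hb : Limited b) : Limited (a * b) := by
  obtain ⟨r, -, hr⟩ := ha.exists_pos
  obtain ⟨s, -, hs⟩ := hb.exists_pos
  refine ⟨r * s, ?_⟩
  rw [abs_mul]
  exact mul_le_mul hr hs (abs_nonneg b) ((abs_nonneg a).trans hr)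

theorem limited_const (r : ℝ) : Limited (Germ.const r : Star U ℝ) :=
  ⟨|r|, (Germ.const_abs r).symm.le⟩

theorem Infinitesimal.sum {α : Type*} (s : Finset α) {a : α → Star U ℝ}
    (h : ∀ i ∈ s, Infinitesimal (a i)) : Infinitesimal (∑ i ∈ s, a i) := by
  classical
  induction s using Finset.induction_on with
  | empty => exact Infinitesimal.zero
  | insert i s hi ih =>
    rw [Finset.sum_insert hi]
    exact (h i (Finset.mem_insert_self i s)).add
      (ih fun b hb => h b (Finset.mem_insert_of_mem hb))

theorem liftPred_lt_iff (x : Star U ℝ) (c : ℝ) : x.LiftPred (· < c) ↔ x < Germ.const c := by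
  induction x using Germ.inductionOn with | _ x =>
  exact Germ.coe_lt.symm

theorem liftPred_abs_sub_lt_iff (x : Star U ℝ) (c δ : ℝ) :
    x.LiftPred (fun u => |u - c| < δ) ↔ |x - Germ.const c| < Germ.const δ := by
  induction x using Germ.inductionOn with | _ x =>
  have e : |(x : Star U ℝ) - Germ.const c| = Germ.ofFun (fun j => |x j - c|) :=
    germ_abs_coe (fun j => x j - c)
  rw [e]
  exact Germ.coe_lt.symm

end Infinitesimal

theorem boundary_inter_subset {J : Type*} {U : Ultrafilter J} {ι : Type*} {N : ι → Star U ℕ}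
    (A B : Set (grid N)) :
    boundary (A ∩ B) ⊆ boundary A ∪ boundary B := by
  rintro ξ ⟨⟨η, ⟨hA, hB⟩, hη⟩, ζ, hζ, hζξ⟩
  by_cases h : ζ ∈ A
  · exact Or.inr ⟨⟨η, hB, hη⟩, ζ, fun hb => hζ ⟨h, hb⟩, hζξ⟩
  · exact Or.inl ⟨⟨η, hA, hη⟩, ζ, h, hζξ⟩

/-! ### Stability of `S`-integrable and fast oscillating functions, and of rare and quadrable sets.
-/

section SIntegrable
variable {J : Type*} {U : Ultrafilter J} {ι : Type*} [Fintype ι] {N : ι → Star U ℕ}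

/-- At each index the representative of `|f|` attains its maximum on the finite grid; the maximizers
form a point of `grid N`, and the limited value of `f` there bounds all the others. -/
theorem exists_uniform_bound {f : grid N → Star U ℝ} (hf : IsInternal f)
    (h : ∀ ξ, Limited (f ξ)) : ∃ C : ℝ, 0 < C ∧ ∀ ξ, |f ξ| ≤ Germ.const C := by
  classical
  obtain ⟨F, hF⟩ := hf
  obtain ⟨n, hn⟩ := exists_representatives N
  have hk : ∀ j, ∃ k : ι → ℕ, (∀ i, k i ≤ n j i) ∧ ∀ l : ι → ℕ, (∀ i, l i ≤ n j i) →
      |F j (fun i => (l i : ℝ) / (n j i : ℝ))| ≤ |F j (fun i => (k i : ℝ) / (n j i : ℝ))| := by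
    intro j
    obtain ⟨k, hk, hmax⟩ := (Fintype.piFinset fun i => Finset.range (n j i + 1)).exists_max_image
      (fun l => |F j (fun i => (l i : ℝ) / (n j i : ℝ))|) ⟨0, by simp⟩
    simp only [Fintype.mem_piFinset, Finset.mem_range, Nat.lt_succ_iff] at hk hmax
    exact ⟨k, hk, hmax⟩
  choose k hk hmax using hk
  obtain ⟨C, hC0, hC⟩ := (h (gridPoint hn hk)).exists_pos
  refine ⟨C, hC0, fun ξ => le_trans ?_ hC⟩
  obtain ⟨l, hl, rfl⟩ := exists_eq_gridPoint hn ξ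
  rw [hF.apply_gridPoint, hF.apply_gridPoint, germ_abs_coe, germ_abs_coe]
  exact Germ.coe_le.2 (Eventually.of_forall fun j => hmax j _ (hl j))

theorem sIntegrable_one : SIntegrable (1 : grid N → Star U ℝ) := by
  have e : (fun ξ : grid N => |(1 : grid N → Star U ℝ) ξ|) = 1 := by ext; simp
  refine ⟨isInternal_const 1, ?_, fun A _ h => by rw [e]; exact h⟩
  rw [e]
  obtain ⟨n, hn⟩ := exists_representatives N
  rw [integral_univ_eq (F := fun _ _ => 1) (fun ξ h => rfl) hn]
  refine ⟨1, ?_⟩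
  rw [germ_abs_coe]
  refine Germ.coe_le.2 (Eventually.of_forall fun j => ?_)
  simp only [gridSum, one_mul, Finset.sum_const, Fintype.card_piFinset, Finset.card_range,
    nsmul_eq_mul, Nat.cast_prod, ← Finset.prod_mul_distrib]
  rw [Finset.abs_prod]
  refine Finset.prod_le_one (fun i _ => abs_nonneg _) fun i _ => ?_
  by_cases h : (n j i : ℝ) = 0
  -- Where `n j i = 0`, division by zero makes the factor `n * (1 / n)` equal to `0`; elsewhere it
  -- is `1`.
  · simp [h]
  · simp [h]

theorem SIntegrable.of_abs_le_mul {f g : grid N → Star U ℝ} (hf : SIntegrable f)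
    (hg : IsInternal g) {C : ℝ} (h : ∀ ξ, |g ξ| ≤ Germ.const C * |f ξ|) : SIntegrable g := by
  have key : ∀ A : Set (grid N), IsInternalSet A →
      |integral A (fun ξ => |g ξ|)| ≤ |Germ.const C * integral A (fun ξ => |f ξ|)| := by
    intro A hA
    rw [abs_of_nonneg (integral_nonneg hA hg.abs fun ξ _ => abs_nonneg _),
      ← integral_const_mul hA _ hf.1.abs]
    exact (integral_mono hA hg.abs ((isInternal_const _).mul hf.1.abs) fun ξ _ => h ξ).trans
      (le_abs_self _)
  exact ⟨hg, ((limited_const C).mul hf.2.1).of_abs_le (key _ IsInternalSet.univ),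
    fun A hA hA0 => ((limited_const C).mul_infinitesimal (hf.2.2 A hA hA0)).of_abs_le (key A hA)⟩

theorem SIntegrable.mul_limited {f c : grid N → Star U ℝ} (hf : SIntegrable f)
    (hc : IsInternal c) (h : ∀ ξ, Limited (c ξ)) : SIntegrable (f * c) := by
  obtain ⟨C, -, hC⟩ := exists_uniform_bound hc h
  refine hf.of_abs_le_mul (hf.1.mul hc) (C := C) fun ξ => ?_
  rw [Pi.mul_apply, abs_mul, mul_comm]
  exact mul_le_mul_of_nonneg_right (hC ξ) (abs_nonneg _)

theorem SIntegrable.neg {f : grid N → Star U ℝ} (hf : SIntegrable f) : SIntegrable (-f) :=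
  hf.of_abs_le_mul hf.1.neg (C := 1) fun ξ => by
    rw [Pi.neg_apply, abs_neg]
    exact (one_mul |f ξ|).ge

theorem SIntegrable.add {f g : grid N → Star U ℝ} (hf : SIntegrable f) (hg : SIntegrable g) :
    SIntegrable (f + g) := by
  have key : ∀ A : Set (grid N), IsInternalSet A → |integral A (fun ξ => |(f + g) ξ|)| ≤
      |integral A (fun ξ => |f ξ|) + integral A (fun ξ => |g ξ|)| := by
    intro A hA
    rw [abs_of_nonneg (integral_nonneg hA (hf.1.add hg.1).abs fun ξ _ => abs_nonneg _),
      ← integral_add hA hf.1.abs hg.1.abs]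
    exact (integral_mono hA (hf.1.add hg.1).abs (hf.1.abs.add hg.1.abs)
      fun ξ _ => abs_add_le _ _).trans (le_abs_self _)
  exact ⟨hf.1.add hg.1, (hf.2.1.add hg.2.1).of_abs_le (key _ IsInternalSet.univ),
    fun A hA hA0 => ((hf.2.2 A hA hA0).add (hg.2.2 A hA hA0)).of_abs_le (key A hA)⟩

theorem SIntegrable.sub {f g : grid N → Star U ℝ} (hf : SIntegrable f) (hg : SIntegrable g) :
    SIntegrable (f - g) := by
  rw [sub_eq_add_neg]; exact hf.add hg.neg

theorem FastOscillating.add {f g : grid N → Star U ℝ} (hf : FastOscillating f)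
    (hg : FastOscillating g) : FastOscillating (f + g) :=
  ⟨hf.1.add hg.1, fun A hA => by
    rw [integral_add hA.1 hf.1.1 hg.1.1]; exact (hf.2 A hA).add (hg.2 A hA)⟩

theorem FastOscillating.sub {f g : grid N → Star U ℝ} (hf : FastOscillating f)
    (hg : FastOscillating g) : FastOscillating (f - g) :=
  ⟨hf.1.sub hg.1, fun A hA => by
    rw [integral_sub hA.1 hf.1.1 hg.1.1]; exact (hf.2 A hA).sub (hg.2 A hA)⟩

theorem IsRare.mono {R S : Set (grid N)} (hS : IsRare S) (h : R ⊆ S) : IsRare R := fun r hr => by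
  obtain ⟨B, hB, hSB, hr⟩ := hS r hr
  exact ⟨B, hB, h.trans hSB, hr⟩

theorem IsRare.union {R S : Set (grid N)} (hR : IsRare R) (hS : IsRare S) :
    IsRare (R ∪ S) := fun r hr => by
  obtain ⟨A, hA, hRA, h₁⟩ := hR (r / 2) (half_pos hr)
  obtain ⟨B, hB, hSB, h₂⟩ := hS (r / 2) (half_pos hr)
  refine ⟨A ∪ B, hA.union hB, Set.union_subset_union hRA hSB, ?_⟩
  have h := add_le_add h₁ h₂
  rw [const_add, add_halves] at h
  exact (measure_union_le hA hB).trans h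

theorem IsQuadrable.inter {A B : Set (grid N)} (hA : IsQuadrable A) (hB : IsQuadrable B) :
    IsQuadrable (A ∩ B) :=
  ⟨hA.1.inter hB.1, (hA.2.union hB.2).mono (boundary_inter_subset A B)⟩

end SIntegrable

/-! ### Quadrable initial segments and moduli of continuity on one axis. -/

section Axis
variable {J : Type*} {U : Ultrafilter J} {M : Star U ℕ}

/-- The points of the axis whose coordinate is in the nonstandard extension of `{u | p u}`. -/
def coordSet (M : Star U ℕ) (p : ℝ → Prop) : Set (grid (fun _ : Unit => M)) :=
  {t | (t.1 ()).LiftPred p}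

open scoped Classical in
theorem represents_coordSet (M : Star U ℕ) (p : ℝ → Prop) :
    Represents (fun _ ξ => if p (ξ ()) then 1 else 0) ((coordSet M p).indicator 1) := by
  intro ξ h
  by_cases hp : ∀ᶠ j in (U : Filter J), p (ξ j ())
  · rw [Set.indicator_of_mem (show _ ∈ coordSet M p from hp)]
    refine Germ.coe_eq.2 ?_
    filter_upwards [hp] with j hj
    simp [hj]
  · rw [Set.indicator_of_notMem (show _ ∉ coordSet M p from hp)]
    refine Germ.coe_eq.2 ?_
    filter_upwards [Ultrafilter.eventually_not.2 hp] with j hj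
    simp [hj]

theorem isInternalSet_coordSet (M : Star U ℕ) (p : ℝ → Prop) : IsInternalSet (coordSet M p) := by
  classical
  exact ⟨_, represents_coordSet M p⟩

open scoped Classical in
-- The admissible `k` are integers in an interval of length `2nδ`, so there are at most `2nδ + 1 ≤
-- 3nδ` of them, each of weight `1/n`.
theorem gridSum_abs_sub_lt_le {n : ℕ} {c δ : ℝ} (hδ : 0 < δ) (hn : 1 ≤ n * δ) :
    gridSum (fun _ : Unit => n) (fun ξ => if |ξ () - c| < δ then 1 else 0) ≤ 3 * δ := by
  have hn0 : (0 : ℝ) < n := by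
    by_contra h
    nlinarith [not_lt.1 h]
  simp only [gridSum, ite_mul, one_mul, zero_mul, ← Finset.sum_filter, Finset.sum_const,
    nsmul_eq_mul, Finset.univ_unique, Finset.prod_singleton]
  rw [mul_one_div, div_le_iff₀ hn0]
  have hcard : ((Fintype.piFinset fun _ : Unit => Finset.range n).filter
      fun k => |(k () : ℝ) / n - c| < δ).card ≤
      (Finset.Icc ⌈(n : ℝ) * (c - δ)⌉ ⌊(n : ℝ) * (c + δ)⌋).card := by
    refine Finset.card_le_card_of_injOn (fun k => (k () : ℤ)) ?_ ?_
    · intro k hk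
      have h := abs_lt.1 (Finset.mem_filter.1 hk).2
      have h₁ : (n : ℝ) * (k () / n) = k () := mul_div_cancel₀ _ hn0.ne'
      refine Finset.mem_coe.2 (Finset.mem_Icc.2 ⟨Int.ceil_le.2 ?_, Int.le_floor.2 ?_⟩)
      · push_cast
        nlinarith
      · push_cast
        nlinarith
    · intro k _ l _ h
      funext u
      exact Int.ofNat_inj.1 h
  rw [Int.card_Icc] at hcard
  have h₁ : (((⌊(n : ℝ) * (c + δ)⌋ + 1 - ⌈(n : ℝ) * (c - δ)⌉).toNat : ℤ) : ℝ) ≤ 3 * δ * n := by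
    rcases le_total 0 (⌊(n : ℝ) * (c + δ)⌋ + 1 - ⌈(n : ℝ) * (c - δ)⌉) with h | h
    · rw [Int.toNat_of_nonneg h]
      push_cast
      nlinarith [Int.floor_le ((n : ℝ) * (c + δ)), Int.le_ceil ((n : ℝ) * (c - δ))]
    · rw [Int.toNat_of_nonpos h]
      push_cast
      positivity
  push_cast at h₁
  convert (Nat.cast_le.2 hcard).trans h₁

theorem measure_coordSet_abs_sub_lt_le (hM : Unlimited M) (c : ℝ) {δ : ℝ} (hδ : 0 < δ) :
    measure (coordSet M (fun u => |u - c| < δ)) ≤ Germ.const (3 * δ) := by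
  classical
  induction M using Germ.inductionOn with | _ n =>
  rw [measure, ← integral_indicator,
    integral_univ_eq (represents_coordSet _ _) (n := fun j _ => n j) (fun _ => rfl)]
  refine Germ.coe_le.2 ?_
  -- Unlimitedness gives `n j ≥ 1 / δ` for almost every `j`, so that the rounding error `1` is
  -- absorbed in `n δ`.
  filter_upwards [Germ.coe_lt.1 (hM ⌈1 / δ⌉₊)] with j hj
  refine gridSum_abs_sub_lt_le hδ ?_
  rw [← div_le_iff₀ hδ]
  exact (Nat.le_ceil _).trans (Nat.cast_le.2 hj.le)

/-- Boundary points are infinitely close to `c`, hence lie in each standard interval around `c`;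
radius `r / 3` gives measure at most `r`. -/
theorem isQuadrable_coordSet_lt (hM : Unlimited M) (c : ℝ) :
    IsQuadrable (coordSet M (· < c)) := by
  refine ⟨isInternalSet_coordSet M _, fun r hr => ?_⟩
  refine ⟨coordSet M (fun u => |u - c| < r / 3), isInternalSet_coordSet M _, ?_, ?_⟩
  · rintro ξ ⟨⟨η, hη, hξη⟩, ζ, hζ, hξζ⟩
    have h₁ := (liftPred_lt_iff _ _).1 hη
    have h₂ := not_lt.1 (fun h => hζ ((liftPred_lt_iff _ _).2 h))
    have h₃ := abs_lt.1 (hξη () (r / 3) (by positivity))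
    have h₄ := abs_lt.1 (hξζ () (r / 3) (by positivity))
    refine (liftPred_abs_sub_lt_iff _ _ _).2 (abs_lt.2 ⟨?_, ?_⟩)
    · linarith [h₄.1]
    · linarith [h₃.2]
  · have h := measure_coordSet_abs_sub_lt_le hM c (δ := r / 3) (by positivity)
    rwa [mul_div_cancel₀ _ three_ne_zero] at h

/-- At each index take, among the pairs of grid points whose values differ by at least `ε`, a
closest one. The resulting internal pair is at least as close as any pair in `*I` violating `ε`, so
a standard lower bound for its distance serves as `δ`. -/
theorem IsClassS0.exists_modulus {c : grid (fun _ : Unit => M) → Star U ℝ} (hc : IsClassS0 c)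
    {ε : ℝ} (hε : 0 < ε) : ∃ δ : ℝ, 0 < δ ∧ ∀ s t : grid (fun _ : Unit => M),
      |s.1 () - t.1 ()| < Germ.const δ → |c s - c t| < Germ.const ε := by
  classical
  obtain ⟨⟨F, hF⟩, -, hcont⟩ := hc
  obtain ⟨n, hn⟩ := exists_representatives (fun _ : Unit => M)
  have hex : ∀ j, ∃ q : (Unit → ℕ) × (Unit → ℕ), ((∀ i, q.1 i ≤ n j i) ∧ ∀ i, q.2 i ≤ n j i) ∧
      ∀ k l : Unit → ℕ, (∀ i, k i ≤ n j i) → (∀ i, l i ≤ n j i) →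
        ε ≤ |F j (fun i => (k i : ℝ) / (n j i : ℝ)) - F j (fun i => (l i : ℝ) / (n j i : ℝ))| →
        ε ≤ |F j (fun i => (q.1 i : ℝ) / (n j i : ℝ)) -
          F j (fun i => (q.2 i : ℝ) / (n j i : ℝ))| ∧
        |(q.1 () : ℝ) / (n j () : ℝ) - (q.2 () : ℝ) / (n j () : ℝ)| ≤
          |(k () : ℝ) / (n j () : ℝ) - (l () : ℝ) / (n j () : ℝ)| := by
    intro j
    let P : Finset (Unit → ℕ) := Fintype.piFinset fun i => Finset.range (n j i + 1)
    have hP : ∀ k : Unit → ℕ, k ∈ P ↔ ∀ i, k i ≤ n j i := fun k => by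
      simp only [P, Fintype.mem_piFinset, Finset.mem_range, Nat.lt_succ_iff]
    let T := (P ×ˢ P).filter fun q => ε ≤ |F j (fun i => (q.1 i : ℝ) / (n j i : ℝ)) -
      F j (fun i => (q.2 i : ℝ) / (n j i : ℝ))|
    have hT : ∀ q, q ∈ T ↔ ((∀ i, q.1 i ≤ n j i) ∧ ∀ i, q.2 i ≤ n j i) ∧
        ε ≤ |F j (fun i => (q.1 i : ℝ) / (n j i : ℝ)) -
          F j (fun i => (q.2 i : ℝ) / (n j i : ℝ))| := fun q => by
      simp only [T, Finset.mem_filter, Finset.mem_product, hP]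
    by_cases hne : T.Nonempty
    · obtain ⟨q, hq, hmin⟩ := T.exists_min_image
        (fun q => |(q.1 () : ℝ) / (n j () : ℝ) - (q.2 () : ℝ) / (n j () : ℝ)|) hne
      have hq' := (hT q).1 hq
      exact ⟨q, hq'.1, fun k l hk hl h => ⟨hq'.2, hmin (k, l) ((hT _).2 ⟨⟨hk, hl⟩, h⟩)⟩⟩
    -- No pair violates `ε` at this index, so the required implication is vacuous and any default
    -- pair will do.
    · exact ⟨(0, 0), ⟨fun _ => Nat.zero_le _, fun _ => Nat.zero_le _⟩,
        fun k l hk hl h => absurd ⟨(k, l), (hT _).2 ⟨⟨hk, hl⟩, h⟩⟩ hne⟩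
  choose q hq hmin using hex
  have key : ∀ s t : grid (fun _ : Unit => M), Germ.const ε ≤ |c s - c t| →
      Germ.const ε ≤ |c (gridPoint hn fun j => (hq j).1) - c (gridPoint hn fun j => (hq j).2)| ∧
      |(gridPoint hn fun j => (hq j).1).1 () - (gridPoint hn fun j => (hq j).2).1 ()| ≤
        |s.1 () - t.1 ()| := by
    intro s t h
    obtain ⟨k, hk, rfl⟩ := exists_eq_gridPoint hn s
    obtain ⟨l, hl, rfl⟩ := exists_eq_gridPoint hn t
    simp only [hF.apply_gridPoint] at h ⊢
    have h' : ∀ᶠ j in (U : Filter J), ε ≤ |F j (fun i => (k j i : ℝ) / (n j i : ℝ)) -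
        F j (fun i => (l j i : ℝ) / (n j i : ℝ))| := by
      refine Germ.coe_le.1 ?_
      rw [← germ_abs_coe]
      exact h
    constructor
    · refine le_of_le_of_eq (Germ.coe_le.2 ?_) (germ_abs_coe _).symm
      filter_upwards [h'] with j hj using (hmin j _ _ (hk j) (hl j) hj).1
    · refine le_of_eq_of_le (germ_abs_coe _) (le_of_le_of_eq (Germ.coe_le.2 ?_)
        (germ_abs_coe _).symm)
      filter_upwards [h'] with j hj using (hmin j _ _ (hk j) (hl j) hj).2
  -- If the extremal pair is infinitely close, `S`-continuity excludes every violation and any `δ`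
  -- works; otherwise its distance exceeds a standard `δ`.
  by_cases hnear : Near (gridPoint hn fun j => (hq j).1) (gridPoint hn fun j => (hq j).2)
  · refine ⟨1, one_pos, fun s t _ => lt_of_not_ge fun h => ?_⟩
    exact absurd (hcont _ _ hnear ε hε) (not_lt.2 (key s t h).1)
  · simp only [Near, Infinitesimal, not_forall, not_lt] at hnear
    obtain ⟨⟨⟩, δ, hδ, hle⟩ := hnear
    refine ⟨δ, hδ, fun s t hst => lt_of_not_ge fun h => ?_⟩
    exact absurd (hle.trans (key s t h).2) (not_le.2 hst)

end Axis

/-! ### Step functions, and products of fast oscillating and `S⁰` functions. -/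

section Product
variable {J : Type*} {U : Ultrafilter J} {M : Star U ℕ}

/-- The points of the axis with `a / K ≤ t < (a + 1) / K`. -/
def cell (M : Star U ℕ) (K a : ℕ) : Set (grid (fun _ : Unit => M)) :=
  {t | Germ.const ((a : ℝ) / K) ≤ t.1 () ∧ t.1 () < Germ.const (((a + 1 : ℕ) : ℝ) / K)}

theorem cell_eq_sdiff (M : Star U ℕ) (K a : ℕ) :
    cell M K a = coordSet M (· < ((a + 1 : ℕ) : ℝ) / K) \ coordSet M (· < (a : ℝ) / K) := by
  ext t
  rw [cell, Set.mem_ofPred_eq, Set.mem_sdiff, coordSet, coordSet, Set.mem_ofPred_eq, Set.mem_ofPred_eq,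
    liftPred_lt_iff, liftPred_lt_iff, not_lt, and_comm]

theorem coordSet_lt_mono (M : Star U ℕ) {b c : ℝ} (h : b ≤ c) :
    coordSet M (· < b) ⊆ coordSet M (· < c) := fun _ ht =>
  (liftPred_lt_iff _ _).2 (((liftPred_lt_iff _ _).1 ht).trans_le (const_le_const.2 h))

theorem indicator_cell (M : Star U ℕ) (K a : ℕ) (f : grid (fun _ : Unit => M) → Star U ℝ) :
    (cell M K a).indicator f = (coordSet M (· < ((a + 1 : ℕ) : ℝ) / K)).indicator f -
      (coordSet M (· < (a : ℝ) / K)).indicator f := by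
  rw [cell_eq_sdiff]
  refine Set.indicator_sdiff (coordSet_lt_mono M ?_) f
  gcongr
  exact Nat.le_succ a

theorem isInternalSet_cell (M : Star U ℕ) (K a : ℕ) : IsInternalSet (cell M K a) := by
  rw [IsInternalSet, indicator_cell]
  exact IsInternal.sub (isInternalSet_coordSet M _) (isInternalSet_coordSet M _)

/-- A cell is a difference of two nested initial segments, so the integral is a difference of
integrals of `h` over two quadrable sets. -/
theorem FastOscillating.infinitesimal_integral_indicator_cell (hM : Unlimited M)
    {h : grid (fun _ : Unit => M) → Star U ℝ} (hh : FastOscillating h)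
    {A : Set (grid (fun _ : Unit => M))} (hA : IsQuadrable A) (K a : ℕ) :
    Infinitesimal (integral A ((cell M K a).indicator h)) := by
  rw [indicator_cell, integral_sub hA.1 ((isInternalSet_coordSet M _).indicator hh.1.1)
    ((isInternalSet_coordSet M _).indicator hh.1.1), ← integral_inter, ← integral_inter]
  exact (hh.2 _ (hA.inter (isQuadrable_coordSet_lt hM _))).sub
    (hh.2 _ (hA.inter (isQuadrable_coordSet_lt hM _)))

theorem coord_mem_Icc (t : grid (fun _ : Unit => M)) : 0 ≤ t.1 () ∧ t.1 () ≤ 1 := by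
  obtain ⟨k, hk, e⟩ := t.2 ()
  rw [e]
  induction M using Germ.inductionOn with | _ n =>
  induction k using Germ.inductionOn with | _ k =>
  constructor
  · exact Germ.coe_le.2 (Eventually.of_forall fun j => by
      change (0 : ℝ) ≤ (k j : ℝ) / (n j : ℝ); positivity)
  · refine Germ.coe_le.2 ?_
    filter_upwards [Germ.coe_le.1 hk] with j hj
    exact div_le_one_of_le₀ (Nat.cast_le.2 hj) (Nat.cast_nonneg _)

/-- The least `a` whose right endpoint exceeds `t` has its left endpoint at most `t`. There are `K +
1` cells rather than `K` because the point `1` lies in cell `K`. -/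
theorem exists_mem_cell {K : ℕ} (hK : 0 < K) (t : grid (fun _ : Unit => M)) :
    ∃ a < K + 1, t ∈ cell M K a := by
  classical
  have hK' : (0 : ℝ) < K := Nat.cast_pos.2 hK
  have hlast : t.1 () < Germ.const (((K + 1 : ℕ) : ℝ) / K) :=
    (coord_mem_Icc t).2.trans_lt (const_lt_const.2 (by
      rw [lt_div_iff₀ hK']; push_cast; linarith))
  have hex : ∃ a : ℕ, t.1 () < Germ.const (((a + 1 : ℕ) : ℝ) / K) := ⟨K, hlast⟩
  refine ⟨Nat.find hex, Nat.lt_succ_of_le (Nat.find_min' hex hlast), ?_, Nat.find_spec hex⟩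
  rcases Nat.eq_zero_or_pos (Nat.find hex) with h0 | h0
  · rw [h0, Nat.cast_zero, zero_div]
    exact (coord_mem_Icc t).1
  · have h := Nat.find_min hex (Nat.sub_lt h0 one_pos)
    rwa [show Nat.find hex - 1 + 1 = Nat.find hex from Nat.sub_add_cancel h0,
      not_lt] at h

theorem eq_of_mem_cell {K a b : ℕ} {t : grid (fun _ : Unit => M)} (ha : t ∈ cell M K a)
    (hb : t ∈ cell M K b) : a = b := by
  have key : ∀ {a b : ℕ}, t ∈ cell M K a → t ∈ cell M K b → ¬ a < b := fun ha hb hab => by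
    refine absurd (hb.1.trans_lt ha.2) (not_lt.2 (const_le_const.2 ?_))
    gcongr
    exact hab
  exact le_antisymm (not_lt.1 (key hb ha)) (not_lt.1 (key ha hb))

theorem abs_sub_lt_of_mem_cell {K a : ℕ} {s t : grid (fun _ : Unit => M)} (hs : s ∈ cell M K a)
    (ht : t ∈ cell M K a) : |s.1 () - t.1 ()| < Germ.const (1 / (K : ℝ)) := by
  have e : (Germ.const (((a + 1 : ℕ) : ℝ) / K) : Star U ℝ) =
      Germ.const ((a : ℝ) / K) + Germ.const (1 / (K : ℝ)) := by
    rw [const_add]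
    exact congrArg Germ.const (by push_cast; rw [add_div])
  have h₁ := e ▸ hs.2
  have h₂ := e ▸ ht.2
  exact abs_lt.2 ⟨by linarith [hs.1], by linarith [ht.1]⟩

/-- Functions of class `S⁰` on an axis are approximated by step functions. -/
theorem IsClassS0.exists_step {c : grid (fun _ : Unit => M) → Star U ℝ} (hc : IsClassS0 c)
    {ε : ℝ} (hε : 0 < ε) : ∃ (K : ℕ) (v : ℕ → Star U ℝ), (∀ a, Limited (v a)) ∧
      ∀ t, |c t - ∑ a ∈ Finset.range (K + 1), (cell M K a).indicator (fun _ => v a) t| ≤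
        Germ.const ε := by
  classical
  obtain ⟨δ, hδ, hmod⟩ := hc.exists_modulus hε
  obtain ⟨K₀, hK₀⟩ := exists_nat_one_div_lt hδ
  rw [← Nat.cast_succ] at hK₀
  -- The cells have width `1 / (K₀ + 1) < δ`; each step takes the value of `c` at some point of its
  -- cell, or `0` if the cell is empty.
  refine ⟨K₀ + 1, fun a => if h : (cell M (K₀ + 1) a).Nonempty then c h.some else 0,
    fun a => ?_, fun t => ?_⟩
  · dsimp only
    split_ifs with h
    · exact hc.2.1 _
    · exact limited_const 0
  · obtain ⟨a, ha, hta⟩ := exists_mem_cell K₀.succ_pos t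
    have hne : (cell M (K₀ + 1) a).Nonempty := ⟨t, hta⟩
    rw [Finset.sum_eq_single_of_mem a (Finset.mem_range.2 ha) fun b _ hb =>
      Set.indicator_of_notMem (fun htb => hb (eq_of_mem_cell htb hta)) _,
      Set.indicator_of_mem hta]
    simp only [dif_pos hne]
    exact (hmod _ _ ((abs_sub_lt_of_mem_cell hta hne.some_mem).trans
      (const_lt_const.2 hK₀))).le

/-- The number of cells is standard, so the integrals over them add up to an infinitesimal; a
hyperfinite partition would not allow this. -/
theorem FastOscillating.mul_isClassS0 (hM : Unlimited M)
    {h c : grid (fun _ : Unit => M) → Star U ℝ} (hh : FastOscillating h) (hc : IsClassS0 c) :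
    FastOscillating (h * c) := by
  refine ⟨hh.1.mul_limited hc.1 hc.2.1, fun A hA r hr => ?_⟩
  obtain ⟨C, hC0, hC⟩ := hh.1.2.1.exists_pos
  -- With `∫ |h| ≤ C`, this accuracy keeps the remainder below `r / 2`, leaving `r / 2` for the
  -- infinitesimal integral of the step part `S`.
  have hε : 0 < r / (2 * C) := by positivity
  obtain ⟨K, v, hv, happrox⟩ := hc.exists_step hε
  have hi : IsInternal h := hh.1.1
  have hterm : ∀ a, IsInternal (fun t => v a * (cell M K a).indicator h t) := fun a =>
    (isInternal_const (v a)).mul ((isInternalSet_cell M K a).indicator hi)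
  set S : grid (fun _ : Unit => M) → Star U ℝ :=
    ∑ a ∈ Finset.range (K + 1), fun t => v a * (cell M K a).indicator h t with hS
  have hSi : IsInternal S := IsInternal.sum _ fun a _ => hterm a
  have hS0 : Infinitesimal (integral A S) := by
    rw [hS, integral_sum hA.1 _ fun a _ => hterm a]
    refine Infinitesimal.sum _ fun a _ => ?_
    rw [integral_const_mul hA.1 _ ((isInternalSet_cell M K a).indicator hi)]
    exact (hv a).mul_infinitesimal (hh.infinitesimal_integral_indicator_cell hM hA K a)
  have hdi : IsInternal (h * c - S) := (hi.mul hc.1).sub hSi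
  have hpt : ∀ t, |(h * c - S) t| ≤ Germ.const (r / (2 * C)) * |h t| := by
    intro t
    have e : (h * c - S) t =
        (c t - ∑ a ∈ Finset.range (K + 1), (cell M K a).indicator (fun _ => v a) t) * h t := by
      rw [hS, Pi.sub_apply, Pi.mul_apply, Finset.sum_apply, sub_mul, Finset.sum_mul, mul_comm]
      congr 1
      refine Finset.sum_congr rfl fun a _ => ?_
      by_cases ht : t ∈ cell M K a <;> simp [ht]
    rw [e, abs_mul]
    exact mul_le_mul_of_nonneg_right (happrox t) (abs_nonneg _)
  have hrest : |integral A (h * c - S)| ≤ Germ.const (r / 2) := by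
    calc |integral A (h * c - S)| ≤ integral A (fun t => |(h * c - S) t|) :=
          abs_integral_le hA.1 hdi
      _ ≤ integral Set.univ (fun t => |(h * c - S) t|) :=
          integral_mono_set hA.1 IsInternalSet.univ (Set.subset_univ A) hdi.abs
            fun _ => abs_nonneg _
      _ ≤ integral Set.univ (fun t => Germ.const (r / (2 * C)) * |h t|) :=
          integral_mono IsInternalSet.univ hdi.abs ((isInternal_const _).mul hi.abs)
            fun t _ => hpt t
      _ = Germ.const (r / (2 * C)) * integral Set.univ (fun t => |h t|) :=
          integral_const_mul IsInternalSet.univ _ hi.abs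
      _ ≤ Germ.const (r / (2 * C)) * Germ.const C :=
          mul_le_mul_of_nonneg_left ((le_abs_self _).trans hC) (const_pos hε).le
      _ = Germ.const (r / 2) := by
          rw [const_mul]; congr 1; field_simp
  have hsum := add_lt_add_of_le_of_lt hrest (hS0 (r / 2) (half_pos hr))
  rw [const_add, add_halves] at hsum
  rw [← sub_add_cancel (h * c) S, integral_add hA.1 hdi hSi]
  exact (abs_add_le _ _).trans_lt hsum

end Product

/-! ### Slices, and the passage from one axis to the whole grid. -/

section Slice
variable {J : Type*} {U : Ultrafilter J} {ι : Type*} [DecidableEq ι] {N : ι → Star U ℕ}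

theorem IsInternal.slice {f : grid N → Star U ℝ} (hf : IsInternal f) (i : ι) (ξ : grid N) :
    IsInternal (slice f i ξ) := by
  obtain ⟨F, hF⟩ := hf
  obtain ⟨n, hn⟩ := exists_representatives N
  obtain ⟨k, hk, rfl⟩ := exists_eq_gridPoint hn ξ
  -- Representatives of the coordinates of `ξ` are frozen, and only coordinate `i` is overwritten.
  refine ⟨fun j t => F j (Function.update (fun l => (k j l : ℝ) / (n j l : ℝ)) i (t ())),
    fun t ht => ?_⟩
  let ζ : J → ι → ℝ := fun j => Function.update (fun l => (k j l : ℝ) / (n j l : ℝ)) i (t j ())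
  have e : (fun l => Germ.ofFun (fun j => ζ j l)) =
      (insertCoord i (gridPoint hn hk) ⟨_, ht⟩).1 := by
    funext l
    by_cases h : l = i
    · subst h
      simp [ζ, insertCoord]
    · simp [ζ, insertCoord, gridPoint, Function.update_of_ne h]
  have hζ : (fun l => Germ.ofFun (fun j => ζ j l)) ∈ grid N := e ▸ Subtype.property _
  exact (congrArg f (Subtype.ext e.symm)).trans (hF ζ hζ)

theorem near_insertCoord (i : ι) (ξ : grid N) {s t : grid (fun _ : Unit => N i)}
    (h : Near s t) : Near (insertCoord i ξ s) (insertCoord i ξ t) := fun l => by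
  by_cases hl : l = i
  · subst hl
    simpa [insertCoord] using h ()
  · simpa [insertCoord, Function.update_of_ne hl] using Infinitesimal.zero

theorem IsClassS0.slice {f : grid N → Star U ℝ} (hf : IsClassS0 f) (i : ι) (ξ : grid N) :
    IsClassS0 (slice f i ξ) :=
  ⟨hf.1.slice i ξ, fun _ => hf.2.1 _, fun _ _ h => hf.2.2 _ _ (near_insertCoord i ξ h)⟩

/-- Adding to a noise the product of a centred noise and a function of class `S⁰` does not change
its means. -/
theorem isNoiseOfMean_add_mul_iff [Fintype ι] (hN : ∀ i, Unlimited (N i))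
    {x 𝔫₁ 𝔫₂ m : grid N → Star U ℝ} (hx : IsClassS0 x) (h₁ : IsNoiseOfMean 𝔫₁ 1) :
    IsNoiseOfMean (𝔫₂ + (𝔫₁ - 1) * x) m ↔ IsNoiseOfMean 𝔫₂ m := by
  have hS : SIntegrable ((𝔫₁ - 1) * x) := (h₁.2.1.sub sIntegrable_one).mul_limited hx.1 hx.2.1
  -- The slice of a product is by definition the product of the slices, so the result on one axis
  -- applies.
  have hF : ∀ i ξ, FastOscillating (slice ((𝔫₁ - 1) * x) i ξ) := fun i ξ =>
    (h₁.2.2 i ξ).mul_isClassS0 (hN i) (hx.slice i ξ)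
  constructor
  · rintro ⟨hm, hn, hfo⟩
    refine ⟨hm, ?_, fun i ξ => ?_⟩
    · simpa using hn.sub hS
    · have e : slice (𝔫₂ - m) i ξ =
          slice (𝔫₂ + (𝔫₁ - 1) * x - m) i ξ - slice ((𝔫₁ - 1) * x) i ξ := by
        ext t
        simp only [slice, Pi.sub_apply, Pi.add_apply]
        ring
      rw [e]
      exact (hfo i ξ).sub (hF i ξ)
  · rintro ⟨hm, hn, hfo⟩
    refine ⟨hm, hn.add hS, fun i ξ => ?_⟩
    have e : slice (𝔫₂ + (𝔫₁ - 1) * x - m) i ξ =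
        slice (𝔫₂ - m) i ξ + slice ((𝔫₁ - 1) * x) i ξ := by
      ext t
      simp only [slice, Pi.sub_apply, Pi.add_apply]
      ring
    rw [e]
    exact (hfo i ξ).add (hF i ξ)

end Slice

end NSNoise

theorem proposition2 {J : Type*} (U : Ultrafilter J) (D : ℕ)
    (N : Fin (D + 1) → NSNoise.Star U ℕ) (hN : ∀ i, NSNoise.Unlimited (N i))
    (x y 𝔫₁ 𝔫₂ : NSNoise.grid N → NSNoise.Star U ℝ)
    (hx : NSNoise.IsClassS1 x)
    (h₁ : NSNoise.IsNoiseOfMean 𝔫₁ 1) (h₂ : NSNoise.IsNoise 𝔫₂)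
    (hy : y = 𝔫₁ * x + 𝔫₂) :
    y = x + (𝔫₂ + (𝔫₁ - 1) * x) ∧
    NSNoise.IsNoise (𝔫₂ + (𝔫₁ - 1) * x) ∧
    ∀ m : NSNoise.grid N → NSNoise.Star U ℝ,
      NSNoise.IsNoiseOfMean (𝔫₂ + (𝔫₁ - 1) * x) m ↔ NSNoise.IsNoiseOfMean 𝔫₂ m := by
  refine ⟨?_, ?_, fun m => NSNoise.isNoiseOfMean_add_mul_iff hN hx.1 h₁⟩
  · rw [hy]
    ring
  · exact h₂.imp fun m hm => (NSNoise.isNoiseOfMean_add_mul_iff hN hx.1 h₁).2 hm
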